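/- Let $n,s\ge 0$ and $k\ge 1$, let $f_1,\dots,f_k,h_1,\dots,h_s\in\mathbb{R}[x_1,\dots,x_n]$, and consider the multiobjective binary problem $$\min\ (f_1(x),\dots,f_k(x))\quad\text{s.t. } h_r(x)=0\ (r=1,\dots,s),\quad x\in\{0,1\}^n .$$ A feasible $x$ is nondominated if there is no feasible $z$ with $f_j(z)\le f_j(x)$ for all $j$ and $f_j(z)<f_j(x)$ for some $j$. Let $X_E$ be the set of nondominated feasible points and $Y_E=\{(f_1(x),\dots,f_k(x)):x\in X_E\}$ the set of efficient vectors. Let $$I=\langle h_1,\dots,h_s,\ y_1-f_1,\dots,y_k-f_k,\ x_1(x_1-1),\dots,x_n(x_n-1)\rangle\subseteq\mathbb{R}[y_1,\dots,y_k,x_1,\dots,x_n],$$ and let $G$ be a Gröbner basis of $I$ for the lexicographic order with $y_k\prec\cdots\prec y_1\prec x_n\prec\cdots\prec x_1$ (a finite subset of $I$ whose leading terms generate the ideal of leading terms of $I$). Write $G^y_l=G\cap\mathbb{R}[y_{l+1},\dots,y_k]$ and $G_l=G\cap\mathbb{R}[y_1,\dots,y_k,x_{l+1},\dots,x_n]$,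 and let $V$ denote real varieties. Consider the following algorithm. (a) Starting from the empty vector, for $l=k-1,\dots,0$ extend every partial solution $(\hat y_{l+2},\dots,\hat y_k)$ found so far in all possible ways to $(\hat y_{l+1},\dots,\hat y_k)\in V(G^y_l)$. Let $\Omega\subseteq\mathbb{R}^k$ be the set of vectors obtained at the end. (b) Let $\widehat Y$ be the set of those $y\in\Omega$ that are minimal in $\Omega$ for the componentwise order. (c) For every $\hat y\in\widehat Y$, starting from the empty vector, for $l=n-1,\dots,0$ extend every partial solution $(\hat x_{l+2},\dots,\hat x_n)$ found so far in all possible ways to $(\hat x_{l+1},\dots,\hat x_n)$ with $(\hat y,\hat x_{l+1},\dots,\hat x_n)\in V(G_l)\cap S_l$, where $S_l$ is the set of all $(y,x_{l+1},\dots,x_n)$ such that $y\in\widehat Y$ and there are $x_1,\dots,x_l$ for which $(x_1,\dots,x_n)$ is feasible. Let $\widehat X\subseteq\mathbb{R}^n$ be the set of all vectors obtained at the end, for all $\hat y\in\widehat Y$. Then: 1. $\widehat Y=Y_E$ and $\widehat X=X_E$. 2. Every one-variable system met by the algorithm has finitely many real solutions: each partial solution reached in (a) has only finitely many extensions in $V(G^y_l)$,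 and, for $\hat y\in\widehat Y$, each partial solution reached in (c) has only finitely many extensions in $V(G_l)$. The latter extensions all lie in $S_l$. 3. If $G=\{1\}$, the problem is infeasible. Conversely, if $G$ is the reduced Gröbner basis of $I$ and the problem is infeasible, then $G=\{1\}$. -/

import Mathlib

noncomputable section

namespace MOPBP

open MvPolynomial

/-! ### The binary multiobjective problem -/

/-- Feasible points of the problem with equality constraints `h` and binary variables. -/
def feasibleSet {n s : ℕ} (h : Fin s → MvPolynomial (Fin n) ℝ) : Set (Fin n → ℝ) :=
  {x | (∀ r, eval x (h r) = 0) ∧ ∀ i, x i = 0 ∨ x i = 1}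

/-- The vector of objective values at `x`. -/
def objective {n k : ℕ} (f : Fin k → MvPolynomial (Fin n) ℝ) (x : Fin n → ℝ) : Fin k → ℝ :=
  fun j => eval x (f j)

/-- `X_E`: the nondominated (Pareto optimal) feasible points. -/
def nondominatedSet {n k s : ℕ} (f : Fin k → MvPolynomial (Fin n) ℝ)
    (h : Fin s → MvPolynomial (Fin n) ℝ) : Set (Fin n → ℝ) :=
  {x | x ∈ feasibleSet h ∧ ¬ ∃ z ∈ feasibleSet h,
    (∀ j, eval z (f j) ≤ eval x (f j)) ∧ ∃ j, eval z (f j) < eval x (f j)}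

/-- `Y_E`: the efficient vectors, i.e. the objective vectors of the nondominated points. -/
def efficientSet {n k s : ℕ} (f : Fin k → MvPolynomial (Fin n) ℝ)
    (h : Fin s → MvPolynomial (Fin n) ℝ) : Set (Fin k → ℝ) :=
  objective f '' nondominatedSet f h

/-! ### Gröbner bases -/

/-- `G` is a Gröbner basis of `I`: a finite subset of `I` whose leading terms generate the ideal
generated by the leading terms of all elements of `I`. -/
def IsGroebnerBasis {σ : Type*} (m : MonomialOrder σ) (I : Ideal (MvPolynomial σ ℝ))
    (G : Finset (MvPolynomial σ ℝ)) : Prop :=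
  (∀ g ∈ G, g ∈ I) ∧
    Ideal.span (m.leadingTerm '' (G : Set (MvPolynomial σ ℝ))) =
      Ideal.span (m.leadingTerm '' (I : Set (MvPolynomial σ ℝ)))

/-- `G` is the reduced Gröbner basis of `I`: its elements are monic, and no monomial of an element
is divisible by the leading monomial of another element. -/
def IsReducedGroebnerBasis {σ : Type*} (m : MonomialOrder σ) (I : Ideal (MvPolynomial σ ℝ))
    (G : Finset (MvPolynomial σ ℝ)) : Prop :=
  IsGroebnerBasis m I G ∧ (∀ g ∈ G, m.leadingCoeff g = 1) ∧
    ∀ g ∈ G, ∀ g' ∈ G, g' ≠ g → ∀ d ∈ g.support, ¬ m.degree g' ≤ d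

/-! ### The ideal and its monomial order -/

/-- The variables `x_1, …, x_n, y_1, …, y_k`, listed in this order. Under `MonomialOrder.lex`
a variable that is listed earlier is larger, so that
`y_k ≺ ⋯ ≺ y_1 ≺ x_n ≺ ⋯ ≺ x_1`. -/
abbrev Var (n k : ℕ) : Type := Fin n ⊕ₗ Fin k

/-- The variable index of `x_i`. -/
abbrev xv {n : ℕ} (k : ℕ) (i : Fin n) : Var n k := Sum.inlₗ i

/-- The variable index of `y_j`. -/
abbrev yv (n : ℕ) {k : ℕ} (j : Fin k) : Var n k := Sum.inrₗ j

/-- `I = ⟨h_r(x), y_j - f_j(x), x_i (x_i - 1)⟩` in `ℝ[x, y]`. -/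
def problemIdeal {n k s : ℕ} (f : Fin k → MvPolynomial (Fin n) ℝ)
    (h : Fin s → MvPolynomial (Fin n) ℝ) : Ideal (MvPolynomial (Var n k) ℝ) :=
  Ideal.span
    (Set.range (fun r => rename (xv k) (h r)) ∪
      Set.range (fun j => X (yv n j) - rename (xv k) (f j)) ∪
      Set.range (fun i : Fin n => X (xv k i) * (X (xv k i) - 1)))

/-! ### Solving triangular systems -/

/-- For `e : τ → σ` selecting some of the variables, the real variety, in `ℝ^τ`, of the set
`G ∩ ℝ[τ]` of those elements of `G` that involve the selected variables only. -/
def elimVariety {σ τ : Type*} (G : Finset (MvPolynomial σ ℝ)) (e : τ → σ) : Set (τ → ℝ) :=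
  {a | ∀ q : MvPolynomial τ ℝ, rename e q ∈ G → eval a q = 0}

/-- The indices `l+1, …, N` (counted from `1`), i.e. `l, …, N-1` counted from `0`. -/
abbrev Tail (N l : ℕ) : Type := {i : Fin N // l ≤ i.val}

/-- Forget the first coordinate: `(a_{l+1}, …, a_N) ↦ (a_{l+2}, …, a_N)`. -/
def dropFirst {N l : ℕ} (a : Tail N l → ℝ) : Tail N (l + 1) → ℝ :=
  fun i => a ⟨i.1, le_trans (Nat.le_succ l) i.2⟩

/-- The partial solutions found by solving successively for the last, the next to last, …
coordinate: begin with the empty vector, and extend a partial solution `(a_{l+2}, …, a_N)` to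
every `(a_{l+1}, a_{l+2}, …, a_N)` that satisfies the conditions `C l` of that step. -/
inductive BackSolve {N : ℕ} (C : (l : ℕ) → Set (Tail N l → ℝ)) :
    (l : ℕ) → (Tail N l → ℝ) → Prop
  | start (a : Tail N N → ℝ) : BackSolve C N a
  | extend {l : ℕ} (hl : l < N) (a : Tail N l → ℝ)
      (hprev : BackSolve C (l + 1) (dropFirst a)) (ha : a ∈ C l) : BackSolve C l a

/-- The vectors in `ℝ^N` found when all coordinates have been solved for. -/
def backSolutions {N : ℕ} (C : (l : ℕ) → Set (Tail N l → ℝ)) : Set (Fin N → ℝ) :=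
  {a | BackSolve C 0 (fun i => a i.1)}

/-! ### The algorithm -/

/-- `V(G^y_l)`, where `G^y_l = G ∩ ℝ[y_{l+1}, …, y_k]`. -/
def yVariety {n k : ℕ} (G : Finset (MvPolynomial (Var n k) ℝ)) (l : ℕ) : Set (Tail k l → ℝ) :=
  elimVariety G (fun j : Tail k l => yv n j.1)

/-- Output of the second step: all `y` obtained by solving for `y_k`, then `y_{k-1}`, …, `y_1`. -/
def ySolutions {n k : ℕ} (G : Finset (MvPolynomial (Var n k) ℝ)) : Set (Fin k → ℝ) :=
  backSolutions (yVariety G)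

/-- Output of the third step: the componentwise minimal vectors among those found. -/
def algorithmY {n k : ℕ} (G : Finset (MvPolynomial (Var n k) ℝ)) : Set (Fin k → ℝ) :=
  {y | y ∈ ySolutions G ∧ ¬ ∃ y' ∈ ySolutions G, (∀ j, y' j ≤ y j) ∧ y' ≠ y}

/-- The fibre over `y` of `V(G_l)`, where `G_l = G ∩ ℝ[y_1, …, y_k, x_{l+1}, …, x_n]`. -/
def xVariety {n k : ℕ} (G : Finset (MvPolynomial (Var n k) ℝ)) (y : Fin k → ℝ) (l : ℕ) :
    Set (Tail n l → ℝ) :=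
  {a | Sum.elim a y ∈
    elimVariety G (Sum.elim (fun i : Tail n l => xv k i.1) (fun j : Fin k => yv n j))}

/-- The fibre over `y` of the set `S_l` of all `(y, x_{l+1}, …, x_n)` such that `y` was selected in
the third step and `(x_{l+1}, …, x_n)` can be completed to a feasible point. -/
def xAdmissible {n k s : ℕ} (h : Fin s → MvPolynomial (Fin n) ℝ)
    (G : Finset (MvPolynomial (Var n k) ℝ)) (y : Fin k → ℝ) (l : ℕ) : Set (Tail n l → ℝ) :=
  {a | y ∈ algorithmY G ∧ ∃ x ∈ feasibleSet h, ∀ i : Tail n l, x i.1 = a i}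

/-- The conditions on `(x_{l+1}, …, x_n)` in the fourth step, for a fixed `y`:
`(y, x_{l+1}, …, x_n) ∈ V(G_l) ∩ S_l`. -/
def xConditions {n k s : ℕ} (h : Fin s → MvPolynomial (Fin n) ℝ)
    (G : Finset (MvPolynomial (Var n k) ℝ)) (y : Fin k → ℝ) (l : ℕ) : Set (Tail n l → ℝ) :=
  xVariety G y l ∩ xAdmissible h G y l

/-- Output of the fourth step: all `x` obtained, for the vectors `y` selected in the third step,
by solving for `x_n`, then `x_{n-1}`, …, `x_1`. -/
def algorithmX {n k s : ℕ} (h : Fin s → MvPolynomial (Fin n) ℝ)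
    (G : Finset (MvPolynomial (Var n k) ℝ)) : Set (Fin n → ℝ) :=
  {x | ∃ y ∈ algorithmY G, x ∈ backSolutions (xConditions h G y)}

end MOPBP

end

/-!
The polynomials `x_i (x_i - 1)` and `y_j - f_j` make the problem ideal `I` the full vanishing ideal
of the finite point set `P = {(x, f(x)) : x feasible}`: the products
`∏_{i ∈ t} x_i * ∏_{i ∉ t} (1 - x_i)` sum to `1`, multiplication by such a product evaluates every
polynomial at a binary point modulo `I`, and the products that belong to infeasible points lie in
`I` (`mem_problemIdeal_iff`).

For a set of variables that is closed under passing to lex-smaller ones, a polynomial of `I` in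
these variables is reduced to zero by elements of the Gröbner basis in these variables only
(`eval_eq_zero_of_mem_elimVariety`). Since a finite set is the zero set of the polynomials that
vanish on it, the real variety of `G ∩ ℝ[τ]` is exactly the projection of `P` to the selected
coordinates (`elimVariety_eq_image`). So every partial solution of the back substitution extends to
a point of `P`: solving for `y` yields exactly the objective vectors of feasible points, and solving
for `x` yields, over each selected `y`, exactly the feasible points with objective vector `y`.
Finiteness and the redundancy of the test `S_l` follow at once.

The last statements rest on `1 ∈ I` if and only if `P` is empty; a reduced Gröbner basis of the unit
ideal contains a monic constant, whose leading monomial divides every monomial.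
-/

namespace MOPBP

open MvPolynomial

/-! ### Gröbner bases and elimination -/

/-- The leading monomial of a nonzero element of `I` is divisible by that of a nonzero element of a
Gröbner basis. -/
theorem IsGroebnerBasis.exists_degree_le {σ : Type*} {m : MonomialOrder σ}
    {I : Ideal (MvPolynomial σ ℝ)} {G : Finset (MvPolynomial σ ℝ)} (hG : IsGroebnerBasis m I G)
    {p : MvPolynomial σ ℝ} (hp : p ∈ I) (hp0 : p ≠ 0) :
    ∃ g ∈ G, g ≠ 0 ∧ m.degree g ≤ m.degree p := by
  have hmem : m.leadingTerm p ∈ Ideal.span (m.leadingTerm '' (G : Set (MvPolynomial σ ℝ))) :=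
    hG.2 ▸ Ideal.subset_span ⟨p, hp, rfl⟩
  rw [m.span_leadingTerm_eq_span_monomial', ← Set.image_image (fun d => monomial d (1 : ℝ)),
    mem_ideal_span_monomial_image] at hmem
  obtain ⟨_, ⟨g, ⟨hg, hg0⟩, rfl⟩, hle⟩ := hmem (m.degree p) (by
    classical
    rw [m.support_leadingTerm' hp0]
    exact Finset.mem_singleton_self _)
  exact ⟨g, hg, hg0, hle⟩

/-- The elimination property of the lexicographic order: a polynomial whose leading monomial
involves only variables from an upper set `U` (an upper set of indices consists of the smaller
variables) involves only variables from `U`. -/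
theorem vars_subset_of_degree_support_subset {σ : Type*} [LinearOrder σ] [WellFoundedGT σ]
    {U : Set σ} (hU : IsUpperSet U) {p : MvPolynomial σ ℝ}
    (hp : ∀ i ∉ U, MonomialOrder.lex.degree p i = 0) : (p.vars : Set σ) ⊆ U := by
  intro i hi
  by_contra hiU
  obtain ⟨d, hd, hid⟩ := (mem_vars_iff_mem_support i).1 hi
  have hle : toLex d ≤ toLex (MonomialOrder.lex.degree p) :=
    MonomialOrder.lex_le_iff.1 (MonomialOrder.lex.le_degree hd)
  have hid' : d i ≠ 0 := Finsupp.mem_support_iff.1 hid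
  rcases hle.lt_or_eq with hlt | heq
  · obtain ⟨j, hj, hlt⟩ := Finsupp.Lex.lt_iff.1 hlt
    rcases lt_or_ge i j with hij | hij
    · exact hid' ((hj i hij).trans (hp i hiU))
    · have := hp j fun hjU => hiU (hU hij hjU)
      simp only [ofLex_toLex] at hlt
      omega
  · exact hid' ((DFunLike.congr_fun (toLex.injective heq) i).trans (hp i hiU))

/-- Elements of `I` in the selected variables vanish on the variety of those elements of a lex
Gröbner basis that involve the selected variables only, when all smaller variables are selected
too. -/
theorem eval_eq_zero_of_mem_elimVariety {σ τ : Type*} [LinearOrder σ] [WellFoundedGT σ]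
    {I : Ideal (MvPolynomial σ ℝ)} {G : Finset (MvPolynomial σ ℝ)}
    (hG : IsGroebnerBasis MonomialOrder.lex I G) {e : τ → σ} (he : Function.Injective e)
    (hU : IsUpperSet (Set.range e)) {a : τ → ℝ} (ha : a ∈ elimVariety G e)
    (q : MvPolynomial τ ℝ) (hq : rename e q ∈ I) : eval a q = 0 := by
  classical
  set m : MonomialOrder σ := MonomialOrder.lex
  induction hs : m.toSyn (m.degree (rename e q)) using WellFoundedLT.induction generalizing q with
  | ind s ih =>
  subst hs
  by_cases hq0 : rename e q = 0
  · rw [(rename_injective e he) (hq0.trans (map_zero _).symm), map_zero]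
  obtain ⟨g, hgG, hg0, hle⟩ := hG.exists_degree_le hq hq0
  have hdeg : ∀ i ∉ Set.range e, m.degree (rename e q) i = 0 := by
    intro i hi
    by_contra h0
    have hv : i ∈ (rename e q).vars :=
      (mem_vars_iff_mem_support i).2 ⟨_, m.degree_mem_support hq0, Finsupp.mem_support_iff.2 h0⟩
    obtain ⟨j, -, rfl⟩ := Finset.mem_image.1 (vars_rename e q hv)
    exact hi ⟨j, rfl⟩
  obtain ⟨g', rfl⟩ := exists_rename_eq_of_vars_subset_range g e he
    (vars_subset_of_degree_support_subset hU fun i hi =>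
      Nat.le_zero.1 ((hle i).trans (hdeg i hi).le))
  have hg' : eval a g' = 0 := ha g' hgG
  have hunit : IsUnit (m.leadingCoeff (rename e g')) :=
    isUnit_iff_ne_zero.2 (m.leadingCoeff_ne_zero_iff.2 hg0)
  by_cases hd0 : m.degree (rename e q) = 0
  · -- A divisor of a constant leading monomial is constant, so a nonzero constant
    -- of `G` would vanish at `a`: the variety is empty.
    have hgd : m.degree (rename e g') = 0 := by
      rw [hd0] at hle
      exact le_antisymm hle zero_le
    have hC := m.eq_C_of_degree_eq_zero hgd
    rw [← rename_C e] at hC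
    rw [rename_injective e he hC, eval_C] at hg'
    exact absurd hg' hunit.ne_zero
  · obtain ⟨d, hd⟩ : ∃ d, rename e (monomial d
        ((hunit.unit⁻¹ : ℝˣ) * m.leadingCoeff (rename e q) : ℝ)) =
        monomial (m.degree (rename e q) - m.degree (rename e g'))
          ((hunit.unit⁻¹ : ℝˣ) * m.leadingCoeff (rename e q) : ℝ) := by
      refine ⟨Finsupp.comapDomain e (m.degree (rename e q) - m.degree (rename e g'))
        he.injOn, ?_⟩
      rw [rename_monomial, Finsupp.mapDomain_comapDomain e he]
      intro i hi
      by_contra hi'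
      have := hdeg i hi'
      simp [this] at hi
    have hred : m.reduce hunit (rename e q) = rename e (q - monomial d
        ((hunit.unit⁻¹ : ℝˣ) * m.leadingCoeff (rename e q) : ℝ) * g') := by
      rw [map_sub, map_mul, hd]
      rfl
    have h1 := ih _ (hred ▸ m.degree_reduce_lt hunit hle hd0) _ (by
      rw [map_sub, map_mul]
      exact I.sub_mem hq (I.mul_mem_left _ (hG.1 _ hgG))) rfl
    simpa [hg'] using h1

/-! ### Polynomials vanishing on finite sets -/

theorem exists_eval_eq_zero_and_eval_ne_zero {τ : Type*} {S : Set (τ → ℝ)} (hS : S.Finite)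
    {b : τ → ℝ} (hb : b ∉ S) :
    ∃ q : MvPolynomial τ ℝ, (∀ a ∈ S, eval a q = 0) ∧ eval b q ≠ 0 := by
  induction S, hS using Set.Finite.induction_on with
  | empty => exact ⟨1, by simp, by simp⟩
  | @insert c S _ _ ih =>
    obtain ⟨q, hq, hqb⟩ := ih fun hbS => hb (Or.inr hbS)
    obtain ⟨i, hi⟩ := Function.ne_iff.1 fun hbc : b = c => hb (Or.inl hbc)
    refine ⟨(X i - C (c i)) * q, ?_, ?_⟩
    · rintro a (rfl | ha)
      · simp
      · simp [hq a ha]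
    · simpa [sub_eq_zero, hqb] using hi

/-- If `e` annihilates each `φ(X_v) - b_v` modulo `I`, then multiplication by `e` evaluates every
polynomial at `b` modulo `I`. -/
theorem sub_eval_mul_mem {σ A : Type*} [CommRing A] [Algebra ℝ A] {I : Ideal A}
    (φ : MvPolynomial σ ℝ →ₐ[ℝ] A) {b : σ → ℝ} {e : A}
    (hb : ∀ v, (φ (X v) - algebraMap ℝ A (b v)) * e ∈ I) (p : MvPolynomial σ ℝ) :
    (φ p - algebraMap ℝ A (eval b p)) * e ∈ I := by
  induction p using MvPolynomial.induction_on with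
  | C c =>
    rw [← algebraMap_eq, AlgHom.commutes, algebraMap_eq, eval_C, sub_self, zero_mul]
    exact I.zero_mem
  | add p q hp hq =>
    convert I.add_mem hp hq using 1
    simp only [map_add]
    ring
  | mul_X p v hp =>
    convert I.add_mem (I.mul_mem_left (φ (X v)) hp)
      (I.mul_mem_left (algebraMap ℝ A (eval b p)) (hb v)) using 1
    simp only [map_mul, eval_X]
    ring

/-! ### The problem ideal as a vanishing ideal -/

/-- The point `(x, f(x))` in the space of all variables. -/
noncomputable def graphPoint {n k : ℕ} (f : Fin k → MvPolynomial (Fin n) ℝ) (x : Fin n → ℝ) :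
    Var n k → ℝ :=
  fun v => Sum.elim x (objective f x) (ofLex v)

theorem eval_graphPoint_rename {n k : ℕ} (f : Fin k → MvPolynomial (Fin n) ℝ) (x : Fin n → ℝ)
    (p : MvPolynomial (Fin n) ℝ) : eval (graphPoint f x) (rename (xv k) p) = eval x p := by
  rw [eval_rename]
  rfl

theorem feasibleSet_finite {n s : ℕ} (h : Fin s → MvPolynomial (Fin n) ℝ) :
    (feasibleSet h).Finite := by
  refine (Set.Finite.pi' fun _ : Fin n => Set.toFinite ({0, 1} : Set ℝ)).subset ?_
  intro x hx i
  exact hx.2 i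

/-- The ideal of the problem consists of all polynomials that vanish at the points `(x, f(x))` with
`x` feasible. -/
theorem mem_problemIdeal_iff {n k s : ℕ} (f : Fin k → MvPolynomial (Fin n) ℝ)
    (h : Fin s → MvPolynomial (Fin n) ℝ) (p : MvPolynomial (Var n k) ℝ) :
    p ∈ problemIdeal f h ↔ ∀ x ∈ feasibleSet h, eval (graphPoint f x) p = 0 := by
  classical
  constructor
  · intro hp x hx
    have hle : problemIdeal f h ≤ RingHom.ker (eval (graphPoint f x)) := by
      refine Ideal.span_le.2 ?_
      rintro _ ((⟨r, rfl⟩ | ⟨j, rfl⟩) | ⟨i, rfl⟩)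
      · simp only [SetLike.mem_coe, RingHom.mem_ker]
        rw [eval_graphPoint_rename, hx.1 r]
      · simp only [SetLike.mem_coe, RingHom.mem_ker]
        rw [map_sub, eval_graphPoint_rename, eval_X]
        exact sub_self _
      · simp only [SetLike.mem_coe, RingHom.mem_ker]
        rw [map_mul, map_sub, eval_X, map_one]
        change x i * (x i - 1) = 0
        rcases hx.2 i with hi | hi <;> simp [hi]
    exact hle hp
  · intro hp
    -- Expand `1 = ∏ i, (x_i + (1 - x_i))`; the set `t` stands for its indicator vector.
    have hsum : p = ∑ t ∈ (Finset.univ : Finset (Fin n)).powerset,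
        p * ((∏ i ∈ t, X (xv k i)) * ∏ i ∈ Finset.univ \ t, (1 - X (xv k i))) := by
      rw [← Finset.mul_sum, ← Finset.prod_add]
      simp
    rw [hsum]
    refine Ideal.sum_mem _ fun t _ => ?_
    set e : MvPolynomial (Var n k) ℝ :=
      (∏ i ∈ t, X (xv k i)) * ∏ i ∈ Finset.univ \ t, (1 - X (xv k i))
    set a : Fin n → ℝ := fun i => if i ∈ t then 1 else 0 with ha
    have hx : ∀ i, (rename (xv k) (X i) - algebraMap ℝ (MvPolynomial (Var n k) ℝ) (a i)) * e ∈
        problemIdeal f h := by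
      intro i
      have hgen : X (xv k i) * (X (xv k i) - 1) ∈ problemIdeal f h :=
        Ideal.subset_span (Or.inr ⟨i, rfl⟩)
      refine Ideal.mem_of_dvd _ ?_ hgen
      rw [rename_X]
      by_cases hi : i ∈ t
      · rw [mul_comm, show a i = 1 from if_pos hi, map_one]
        exact mul_dvd_mul_left _ ((Finset.dvd_prod_of_mem (fun i => X (xv k i)) hi).mul_right _)
      · rw [show a i = 0 from if_neg hi, map_zero, sub_zero]
        refine mul_dvd_mul_left _ (Dvd.dvd.mul_left ?_ _)
        rw [← neg_sub, neg_dvd]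
        exact Finset.dvd_prod_of_mem (fun i => 1 - X (xv k i))
          (Finset.mem_sdiff.2 ⟨Finset.mem_univ i, hi⟩)
    have hren := sub_eval_mul_mem (rename (xv k)) hx
    by_cases hfeas : a ∈ feasibleSet h
    · have hall := sub_eval_mul_mem (I := problemIdeal f h) (b := graphPoint f a) (e := e)
        (AlgHom.id ℝ (MvPolynomial (Var n k) ℝ)) (fun v => by
          rcases hv : ofLex v with i | j
          · obtain rfl : v = xv k i := hv
            have hi := hx i
            rwa [rename_X] at hi
          · obtain rfl : v = yv n j := hv
            have hgen : X (yv n j) - rename (xv k) (f j) ∈ problemIdeal f h :=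
              Ideal.subset_span (Or.inl (Or.inr ⟨j, rfl⟩))
            convert Ideal.add_mem _ (Ideal.mul_mem_right e _ hgen) (hren (f j)) using 1
            rw [AlgHom.id_apply, ← add_mul, sub_add_sub_cancel]
            rfl) p
      rw [hp a hfeas] at hall
      simpa using hall
    · -- Some constraint `h_r` has a nonzero, hence invertible, value at the binary point `a`.
      have hr : ∃ r, eval a (h r) ≠ 0 := by
        by_contra! hr
        refine hfeas ⟨hr, fun i => ?_⟩
        by_cases hi : i ∈ t <;> simp [ha, hi]
      obtain ⟨r, hr⟩ := hr
      have hgen : rename (xv k) (h r) ∈ problemIdeal f h :=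
        Ideal.subset_span (Or.inl (Or.inl ⟨r, rfl⟩))
      have hce := Ideal.sub_mem _ (Ideal.mul_mem_right e _ hgen) (hren (h r))
      rw [← sub_mul, sub_sub_cancel, algebraMap_eq] at hce
      have he' := Ideal.mul_mem_left _ (C (eval a (h r))⁻¹) hce
      rw [← mul_assoc, ← C_mul, inv_mul_cancel₀ hr, C_1, one_mul] at he'
      exact Ideal.mul_mem_left _ _ he'

/-- The variety of the part of a lex Gröbner basis in the selected variables is the projection of
the points `(x, f(x))`, `x` feasible, when all smaller variables are selected too. -/
theorem elimVariety_eq_image {n k s : ℕ} {f : Fin k → MvPolynomial (Fin n) ℝ}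
    {h : Fin s → MvPolynomial (Fin n) ℝ} {G : Finset (MvPolynomial (Var n k) ℝ)}
    (hG : IsGroebnerBasis MonomialOrder.lex (problemIdeal f h) G) {τ : Type*} {e : τ → Var n k}
    (he : Function.Injective e) (hU : IsUpperSet (Set.range e)) :
    elimVariety G e = (fun x => graphPoint f x ∘ e) '' feasibleSet h := by
  refine Set.Subset.antisymm (fun b hb => ?_) ?_
  · by_contra hbS
    obtain ⟨q, hq, hqb⟩ :=
      exists_eval_eq_zero_and_eval_ne_zero ((feasibleSet_finite h).image _) hbS
    refine hqb (eval_eq_zero_of_mem_elimVariety hG he hU hb q ?_)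
    rw [mem_problemIdeal_iff]
    intro x hx
    rw [eval_rename]
    exact hq _ ⟨x, hx, rfl⟩
  · rintro _ ⟨x, hx, rfl⟩ q hq
    rw [← eval_rename]
    exact (mem_problemIdeal_iff f h _).1 (hG.1 _ hq) x hx

/-- The points of `V(G^y_l)` are the tails of the objective vectors of feasible points. -/
theorem yVariety_eq_image {n k s : ℕ} {f : Fin k → MvPolynomial (Fin n) ℝ}
    {h : Fin s → MvPolynomial (Fin n) ℝ} {G : Finset (MvPolynomial (Var n k) ℝ)}
    (hG : IsGroebnerBasis MonomialOrder.lex (problemIdeal f h) G) (l : ℕ) :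
    yVariety G l = (fun x (j : Tail k l) => objective f x j.1) '' feasibleSet h := by
  refine elimVariety_eq_image hG ?_ ?_
  · intro j j' hj
    exact Subtype.ext (Sum.inr_injective (toLex.injective hj))
  · rintro _ v hv ⟨j, rfl⟩
    rcases hw : ofLex v with i | j'
    · obtain rfl : v = xv k i := hw
      exact absurd hv Sum.Lex.not_inr_le_inl
    · obtain rfl : v = yv n j' := hw
      have hj : j.1 ≤ j' := Sum.Lex.inr_le_inr_iff.1 hv
      exact ⟨⟨j', j.2.trans hj⟩, rfl⟩

/-- The points of `V(G_l)` over `y` are the tails of the feasible points with objective vector `y`,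
even without the test `S_l`. -/
theorem xVariety_eq_image {n k s : ℕ} {f : Fin k → MvPolynomial (Fin n) ℝ}
    {h : Fin s → MvPolynomial (Fin n) ℝ} {G : Finset (MvPolynomial (Var n k) ℝ)}
    (hG : IsGroebnerBasis MonomialOrder.lex (problemIdeal f h) G) (y : Fin k → ℝ) (l : ℕ) :
    xVariety G y l =
      (fun x (i : Tail n l) => x i.1) '' {x | x ∈ feasibleSet h ∧ objective f x = y} := by
  ext a
  rw [xVariety, Set.mem_ofPred_eq, elimVariety_eq_image hG]
  · constructor
    · rintro ⟨x, hx, hxa⟩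
      exact ⟨x, ⟨hx, funext fun j => congrFun hxa (Sum.inr j)⟩,
        funext fun i => congrFun hxa (Sum.inl i)⟩
    · rintro ⟨x, ⟨hx, rfl⟩, rfl⟩
      refine ⟨x, hx, funext ?_⟩
      rintro (i | j) <;> rfl
  · rintro (i | j) (i' | j') hij
    · exact congrArg Sum.inl (Subtype.ext (Sum.inl_injective (toLex.injective hij)))
    · exact absurd (toLex.injective hij) Sum.inl_ne_inr
    · exact absurd (toLex.injective hij) Sum.inr_ne_inl
    · exact congrArg Sum.inr (Sum.inr_injective (toLex.injective hij))
  · rintro _ v hv ⟨w, rfl⟩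
    rcases hw : ofLex v with i | j
    · obtain rfl : v = xv k i := hw
      rcases w with i' | j'
      · have hi : i'.1 ≤ i := Sum.Lex.inl_le_inl_iff.1 hv
        exact ⟨Sum.inl ⟨i, i'.2.trans hi⟩, rfl⟩
      · exact absurd hv Sum.Lex.not_inr_le_inl
    · exact ⟨Sum.inr j, hw.symm⟩

/-! ### Back substitution -/

theorem BackSolve.mem_of_lt {N : ℕ} {C : (l : ℕ) → Set (Tail N l → ℝ)} {l : ℕ}
    {a : Tail N l → ℝ} (ha : BackSolve C l a) (hl : l < N) : a ∈ C l := by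
  cases ha with
  | start => exact absurd hl (lt_irrefl _)
  | extend _ _ _ ha => exact ha

/-- A vector all of whose tails satisfy the conditions is found by back substitution. -/
theorem mem_backSolutions {N : ℕ} {C : (l : ℕ) → Set (Tail N l → ℝ)} {a : Fin N → ℝ}
    (ha : ∀ l < N, (fun i : Tail N l => a i.1) ∈ C l) : a ∈ backSolutions C := by
  have key : ∀ l ≤ N, BackSolve C l (fun i => a i.1) := by
    intro l hl
    induction hl using Nat.decreasingInduction with
    | self => exact .start _
    | of_succ l hl ih => exact .extend hl _ ih (ha l hl)
  exact key 0 (Nat.zero_le N)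

theorem ySolutions_eq_image {n k s : ℕ} (hk : 0 < k) {f : Fin k → MvPolynomial (Fin n) ℝ}
    {h : Fin s → MvPolynomial (Fin n) ℝ} {G : Finset (MvPolynomial (Var n k) ℝ)}
    (hG : IsGroebnerBasis MonomialOrder.lex (problemIdeal f h) G) :
    ySolutions G = objective f '' feasibleSet h := by
  ext y
  constructor
  · -- The condition of the last step already describes full vectors; the step exists as `0 < k`.
    intro hy
    have hmem := BackSolve.mem_of_lt hy hk
    rw [yVariety_eq_image hG] at hmem
    obtain ⟨x, hx, hxy⟩ := hmem
    exact ⟨x, hx, funext fun j => congrFun hxy ⟨j, Nat.zero_le _⟩⟩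
  · rintro ⟨x, hx, rfl⟩
    refine mem_backSolutions fun l _ => ?_
    rw [yVariety_eq_image hG]
    exact ⟨x, hx, rfl⟩

/-! ### Correctness of the algorithm -/

theorem objective_mem_algorithmY_iff {n k s : ℕ} (hk : 0 < k)
    {f : Fin k → MvPolynomial (Fin n) ℝ} {h : Fin s → MvPolynomial (Fin n) ℝ}
    {G : Finset (MvPolynomial (Var n k) ℝ)}
    (hG : IsGroebnerBasis MonomialOrder.lex (problemIdeal f h) G) {x : Fin n → ℝ}
    (hx : x ∈ feasibleSet h) : objective f x ∈ algorithmY G ↔ x ∈ nondominatedSet f h := by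
  rw [algorithmY, Set.mem_ofPred_eq, ySolutions_eq_image hk hG, nondominatedSet, Set.mem_ofPred_eq,
    Set.exists_mem_image]
  refine and_congr (iff_of_true ⟨x, hx, rfl⟩ hx) (not_congr ?_)
  refine exists_congr fun z => and_congr_right fun _ => and_congr_right fun hle => ?_
  rw [Function.ne_iff]
  exact exists_congr fun j => (hle j).lt_iff_ne.symm

theorem algorithmY_eq_efficientSet {n k s : ℕ} (hk : 0 < k)
    {f : Fin k → MvPolynomial (Fin n) ℝ} {h : Fin s → MvPolynomial (Fin n) ℝ}
    {G : Finset (MvPolynomial (Var n k) ℝ)}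
    (hG : IsGroebnerBasis MonomialOrder.lex (problemIdeal f h) G) :
    algorithmY G = efficientSet f h := by
  ext y
  constructor
  · intro hy
    have hy' := hy.1
    rw [ySolutions_eq_image hk hG] at hy'
    obtain ⟨x, hx, rfl⟩ := hy'
    exact ⟨x, (objective_mem_algorithmY_iff hk hG hx).1 hy, rfl⟩
  · rintro ⟨x, hx, rfl⟩
    exact (objective_mem_algorithmY_iff hk hG hx.1).2 hx

theorem xVariety_subset_xAdmissible {n k s : ℕ} {f : Fin k → MvPolynomial (Fin n) ℝ}
    {h : Fin s → MvPolynomial (Fin n) ℝ} {G : Finset (MvPolynomial (Var n k) ℝ)}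
    (hG : IsGroebnerBasis MonomialOrder.lex (problemIdeal f h) G) {y : Fin k → ℝ}
    (hy : y ∈ algorithmY G) (l : ℕ) : xVariety G y l ⊆ xAdmissible h G y l := by
  rw [xVariety_eq_image hG]
  rintro _ ⟨x, ⟨hx, -⟩, rfl⟩
  exact ⟨hy, x, hx, fun _ => rfl⟩

theorem backSolutions_xConditions {n k s : ℕ} {f : Fin k → MvPolynomial (Fin n) ℝ}
    {h : Fin s → MvPolynomial (Fin n) ℝ} {G : Finset (MvPolynomial (Var n k) ℝ)}
    (hG : IsGroebnerBasis MonomialOrder.lex (problemIdeal f h) G) {y : Fin k → ℝ}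
    (hy : y ∈ algorithmY G) (hyE : y ∈ efficientSet f h) :
    backSolutions (xConditions h G y) = {x | x ∈ feasibleSet h ∧ objective f x = y} := by
  ext x
  constructor
  · intro hx
    rcases Nat.eq_zero_or_pos n with rfl | hn
    · -- Without variables `x` no condition is checked, and the only point is the one over `y`.
      obtain ⟨z, hz, rfl⟩ := hyE
      rw [Subsingleton.elim x z]
      exact ⟨hz.1, rfl⟩
    · have hmem := (BackSolve.mem_of_lt hx hn).1
      rw [xVariety_eq_image hG] at hmem
      obtain ⟨z, hz, hzx⟩ := hmem
      rwa [show x = z from funext fun i => (congrFun hzx ⟨i, Nat.zero_le _⟩).symm]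
  · intro hx
    refine mem_backSolutions fun l _ => ?_
    have hmem : (fun i : Tail n l => x i.1) ∈ xVariety G y l := by
      rw [xVariety_eq_image hG]
      exact ⟨x, hx, rfl⟩
    exact ⟨hmem, xVariety_subset_xAdmissible hG hy l hmem⟩

theorem algorithmX_eq_nondominatedSet {n k s : ℕ} (hk : 0 < k)
    {f : Fin k → MvPolynomial (Fin n) ℝ} {h : Fin s → MvPolynomial (Fin n) ℝ}
    {G : Finset (MvPolynomial (Var n k) ℝ)}
    (hG : IsGroebnerBasis MonomialOrder.lex (problemIdeal f h) G) :
    algorithmX h G = nondominatedSet f h := by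
  ext x
  constructor
  · rintro ⟨y, hy, hx⟩
    rw [backSolutions_xConditions hG hy (algorithmY_eq_efficientSet hk hG ▸ hy)] at hx
    obtain ⟨hx, rfl⟩ := hx
    exact (objective_mem_algorithmY_iff hk hG hx).1 hy
  · intro hx
    have hy := (objective_mem_algorithmY_iff hk hG hx.1).2 hx
    refine ⟨objective f x, hy, ?_⟩
    rw [backSolutions_xConditions hG hy ⟨x, hx, rfl⟩]
    exact ⟨hx.1, rfl⟩

/-! ### Infeasibility -/

theorem one_mem_problemIdeal_iff {n k s : ℕ} (f : Fin k → MvPolynomial (Fin n) ℝ)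
    (h : Fin s → MvPolynomial (Fin n) ℝ) : 1 ∈ problemIdeal f h ↔ feasibleSet h = ∅ := by
  simp [mem_problemIdeal_iff, Set.eq_empty_iff_forall_notMem]

/-- The reduced Gröbner basis of the unit ideal is `{1}`. -/
theorem IsReducedGroebnerBasis.eq_singleton_one {σ : Type*} {m : MonomialOrder σ}
    {I : Ideal (MvPolynomial σ ℝ)} {G : Finset (MvPolynomial σ ℝ)}
    (hG : IsReducedGroebnerBasis m I G) (hI : 1 ∈ I) : G = {1} := by
  obtain ⟨hGB, hmonic, hred⟩ := hG
  obtain ⟨g, hgG, -, hle⟩ := hGB.exists_degree_le hI one_ne_zero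
  rw [m.degree_one] at hle
  have hg1 : g = 1 := by
    rw [m.eq_C_of_degree_eq_zero (le_antisymm hle zero_le), hmonic g hgG, C_1]
  subst hg1
  refine Finset.eq_singleton_iff_unique_mem.2 ⟨hgG, fun g hg => ?_⟩
  by_contra hne
  have hg0 : g ≠ 0 := fun h0 => by simpa [h0] using hmonic g hg
  refine hred g hg 1 hgG (Ne.symm hne) _ (m.degree_mem_support hg0) ?_
  rw [m.degree_one]
  exact zero_le

end MOPBP

theorem mainTheorem1 {n k s : ℕ} (hk : 0 < k)
    (f : Fin k → MvPolynomial (Fin n) ℝ) (h : Fin s → MvPolynomial (Fin n) ℝ)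
    (G : Finset (MvPolynomial (MOPBP.Var n k) ℝ))
    (hG : MOPBP.IsGroebnerBasis MonomialOrder.lex (MOPBP.problemIdeal f h) G) :
    -- the outputs are exactly the efficient and the nondominated sets
    MOPBP.algorithmY G = MOPBP.efficientSet f h ∧
    MOPBP.algorithmX h G = MOPBP.nondominatedSet f h ∧
    -- every one-variable system met in solving for `y` has finitely many solutions
    (∀ l < k, ∀ a : MOPBP.Tail k (l + 1) → ℝ, MOPBP.BackSolve (MOPBP.yVariety G) (l + 1) a →
      {b : MOPBP.Tail k l → ℝ | MOPBP.dropFirst b = a ∧ b ∈ MOPBP.yVariety G l}.Finite) ∧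
    -- the same in solving for `x`, where moreover every solution passes the test `S_l`
    (∀ y ∈ MOPBP.algorithmY G, ∀ l < n, ∀ a : MOPBP.Tail n (l + 1) → ℝ,
      MOPBP.BackSolve (MOPBP.xConditions h G y) (l + 1) a →
      {b : MOPBP.Tail n l → ℝ | MOPBP.dropFirst b = a ∧ b ∈ MOPBP.xVariety G y l}.Finite ∧
      {b : MOPBP.Tail n l → ℝ | MOPBP.dropFirst b = a ∧ b ∈ MOPBP.xVariety G y l} ⊆
        MOPBP.xAdmissible h G y l) ∧
    -- `G = {1}` certifies infeasibility, and for the reduced basis the certificate always appears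
    (G = {1} → MOPBP.feasibleSet h = ∅) ∧
    (MOPBP.IsReducedGroebnerBasis MonomialOrder.lex (MOPBP.problemIdeal f h) G →
      MOPBP.feasibleSet h = ∅ → G = {1}) := by
  refine ⟨MOPBP.algorithmY_eq_efficientSet hk hG, MOPBP.algorithmX_eq_nondominatedSet hk hG,
    fun l _ a _ => ?_, fun y hy l _ a _ => ⟨?_, fun b hb =>
      MOPBP.xVariety_subset_xAdmissible hG hy l hb.2⟩, ?_, fun hred hempty =>
      hred.eq_singleton_one ((MOPBP.one_mem_problemIdeal_iff f h).2 hempty)⟩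
  · refine Set.Finite.subset ?_ fun b hb => hb.2
    rw [MOPBP.yVariety_eq_image hG]
    exact (MOPBP.feasibleSet_finite h).image _
  · refine Set.Finite.subset ?_ fun b hb => hb.2
    rw [MOPBP.xVariety_eq_image hG]
    exact ((MOPBP.feasibleSet_finite h).subset fun x hx => hx.1).image _
  · rintro rfl
    exact (MOPBP.one_mem_problemIdeal_iff f h).1 (hG.1 1 (Finset.mem_singleton_self 1))
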